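/- **Setting.** For a set $S$ write $\binom{S}{i}$ for the set of its $i$-element subsets. A $k$-palette is a sequence $K=(K_i)_{i=0}^k$ of standard Borel spaces; it is finite if every $K_i$ is a finite set (with its discrete topology and σ-algebra). Put $K^{(S)}:=\prod_{i=0}^k K_i^{\binom{S}{i}}$, with the product topology (where the $K_i$ have topologies) and product σ-algebra, and let $\pi_e$ denote the coordinate projection indexed by $e\in\binom{S}{\le k}$. A random $K$-coloured hypergraph on $S$ is a probability measure on $K^{(S)}$; it is exchangeable if it is invariant under $(\omega_e)_e\mapsto(\omega_{g(e)})_e$ for every finitely supported permutation $g$ of $S$. For a sequence of maps $\Lambda_i:Y_i\to Z_i$ between the spaces of two $k$-palettes, $\Lambda^{(S)}:Y^{(S)}\to Z^{(S)}$ is the map applying $\Lambda_{|e|}$ to the coordinate indexed by each $e$. For disjoint infinite sets $S_1,S_2$, the $S_2$-internalization of $K$ is the palette $K^{\uplus S_2}$ with $$K_i^{\uplus S_2}:=\prod_{j=i}^{k}K_j^{\binom{S_2}{j-i}},$$ and for a random $K$-coloured hypergraph $\mu'$ on $S_1\cup S_2$, its internalization $(\mu')^{\uplus S_2}$ is its image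 under the canonical identification $K^{(S_1\cup S_2)}\cong (K^{\uplus S_2})^{(S_1)}$ which assigns to each $u\in\binom{S_1}{i}$ the family of colours of all edges $u\cup w$ with $w\subseteq S_2$, $|w|\le k-i$. **Theorem 3.17.** Let $K$ be a finite $k$-palette, let $S_1$ and $S_2$ be disjoint countably infinite sets, and let $\mu$ be an exchangeable random $K$-coloured hypergraph on $S_1$. Then there is a unique exchangeable random $K$-coloured hypergraph $\mu'$ on $S_1\cup S_2$ whose restriction to $S_1$ has law $\mu$. Moreover, there are a $k$-palette $Z=(Z_i)_{i=0}^k$ of totally disconnected compact metric spaces with their Borel σ-algebras (each therefore homeomorphic to a closed subset of the Cantor space $\{0,1\}^{\mathbb N}$), and continuous maps $\kappa_i:Z_i\to K_i$ and $\Lambda_i:K_i^{\uplus S_2}\to Z_i$ for $0\le i\le k$, such that, writing $\nu:=\Lambda^{(S_1)}_{\#}(\mu')^{\uplus S_2}$ on $Z^{(S_1)}$, 1. for every $0\le i\le k$, under $\nu$ the random variables $\pi_e$, $e\in\binom{S_1}{i}$, are conditionally independent given the σ-algebra generated by all $\pi_u$ with $u\subseteq S_1$, $|u|<i$; 2. $\mu=\kappa^{(S_1)}_{\#}\,\nu$.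 -/

import Mathlib

open MeasureTheory

universe u v w

namespace Exch

/-- The space `K₀ × K₁^S × ⋯ × K_k^(S choose k)` of hypergraphs on the vertex set `S` coloured by
the `k`-palette `K = (K₀, …, K_k)`: each `i`-subset of `S` receives a colour in `K i`. It carries
the product topology and the product σ-algebra whenever the `K i` carry such structures. -/
abbrev Hypergraph {k : ℕ} (K : Fin (k + 1) → Type u) (S : Type v) : Type (max u v) :=
  ∀ i : Fin (k + 1), Set.powersetCard S (i : ℕ) → K i

/-- The hypergraph `(ω_{f(e)})_e` on `S` induced from `ω` by an injection `f : S → T`. For a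
permutation `f` of `S` this is the coordinate-permuting action on coloured hypergraphs; for the
inclusion of a subset it is the restriction to that subset. -/
def pullback {k : ℕ} {K : Fin (k + 1) → Type u} {S : Type v} {T : Type w} (f : S ↪ T)
    (ω : Hypergraph K T) : Hypergraph K S :=
  fun i e => ω i (Set.powersetCard.map (i : ℕ) f e)

/-- Invariance of a measure on coloured hypergraphs under all finitely supported permutations of
the vertices. -/
def IsExchangeable {k : ℕ} {K : Fin (k + 1) → Type u} [∀ i, MeasurableSpace (K i)] {S : Type v}
    (μ : Measure (Hypergraph K S)) : Prop :=
  ∀ g : Equiv.Perm S, {s | g s ≠ s}.Finite → μ.map (pullback g.toEmbedding) = μ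

/-- `μ'` is an exchangeable random coloured hypergraph on the disjoint union of `S₁` and `S₂`
whose restriction to `S₁` has law `μ`. -/
structure IsExchangeableExtension {k : ℕ} {K : Fin (k + 1) → Type u}
    [∀ i, MeasurableSpace (K i)] {S₁ : Type v} {S₂ : Type w}
    (μ : Measure (Hypergraph K S₁)) (μ' : Measure (Hypergraph K (S₁ ⊕ S₂))) : Prop where
  isProbabilityMeasure : IsProbabilityMeasure μ'
  isExchangeable : IsExchangeable μ'
  map_restrict : μ'.map (pullback Function.Embedding.inl) = μ

/-- The hypergraph power over `S` of a sequence of maps between the colour spaces of two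
palettes. -/
def power {k : ℕ} {Y : Fin (k + 1) → Type u} {Z : Fin (k + 1) → Type v}
    (Λ : ∀ i, Y i → Z i) (S : Type w) (ω : Hypergraph Y S) : Hypergraph Z S :=
  fun i e => Λ i (ω i e)

/-- The `S₂`-internalization of the palette `K`: its `i`-th colour space is
`∏_{i ≤ j ≤ k} K_j ^ (S₂ choose (j - i))`. -/
abbrev internalPalette {k : ℕ} (K : Fin (k + 1) → Type u) (S₂ : Type w) (i : Fin (k + 1)) :
    Type (max u w) :=
  ∀ j : {j : Fin (k + 1) // i ≤ j}, Set.powersetCard S₂ ((j.1 : ℕ) - (i : ℕ)) → K j.1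

/-- The edge `u ∪ w` of `S₁ ∪ S₂` with `u ⊆ S₁` of size `i` and `w ⊆ S₂` of size `j - i`. -/
def joinEdge {S₁ : Type v} {S₂ : Type w} {i j : ℕ} (h : i ≤ j) (u : Set.powersetCard S₁ i)
    (w : Set.powersetCard S₂ (j - i)) : Set.powersetCard (S₁ ⊕ S₂) j :=
  Set.powersetCard.ofCard (s := u.1.disjSum w.1) (by
    rw [Finset.card_disjSum, Set.powersetCard.card_eq u, Set.powersetCard.card_eq w]
    exact Nat.add_sub_cancel' h)

/-- The canonical identification of `K`-coloured hypergraphs on `S₁ ∪ S₂` with hypergraphs on `S₁`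
coloured by the `S₂`-internalization of `K`: the colour of `u ⊆ S₁` records the `K`-colours of all
edges of `S₁ ∪ S₂` that meet `S₁` exactly in `u`. -/
def internalize {k : ℕ} {K : Fin (k + 1) → Type u} {S₁ : Type v} {S₂ : Type w}
    (ω : Hypergraph K (S₁ ⊕ S₂)) : Hypergraph (internalPalette K S₂) S₁ :=
  fun _ u j w => ω j.1 (joinEdge j.2 u w)

/-- The σ-algebra on the space of `Z`-coloured hypergraphs that is generated by the colours of all
edges of size less than `i`. -/
@[reducible] def lowerRank {k : ℕ} (Z : Fin (k + 1) → Type u) [∀ i, MeasurableSpace (Z i)] (S : Type v)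
    (i : Fin (k + 1)) : MeasurableSpace (Hypergraph Z S) :=
  ⨆ (j : Fin (k + 1)) (_ : j < i) (u : Set.powersetCard S (j : ℕ)),
    MeasurableSpace.comap (fun ω : Hypergraph Z S => ω j u) inferInstance

theorem lowerRank_le {k : ℕ} (Z : Fin (k + 1) → Type u) [∀ i, MeasurableSpace (Z i)] (S : Type v)
    (i : Fin (k + 1)) : lowerRank Z S i ≤ (inferInstance : MeasurableSpace (Hypergraph Z S)) := by
  refine iSup_le fun j => iSup_le fun _ => iSup_le fun u => Measurable.comap_le ?_
  exact (measurable_pi_apply u).comp (measurable_pi_apply j)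

end Exch

/-! ### Conditional expectation under measure-preserving maps. -/

namespace MeasureTheory

variable {Ω Ω' : Type*}

/-! The law an exchangeable hypergraph induces along an injection of vertices does not depend on the
injection (`IsExchangeable.map_pullback_eq`). As `S₁ ⊕ S₂` injects into `S₁`, this gives the
extension and its uniqueness.

For the second claim the internalization itself serves: `Z` is the internal palette, `Λ` the
identity, and `κ` reads off the colour of the edge with empty `S₂`-part. What remains is conditional
independence. Fix `u ⊆ S₁` of size `i` and an event about its internal colour involving only a
finite `T ⊆ S₂`. Some injection `ψ` fixes `u ∪ T` and sends all other vertices into `S₂`. Pulling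
back along `ψ` preserves the law and the event, but turns edges not containing `u` into edges whose
trace on `S₁` is a proper subset of `u`. Conditioning on the smaller pulled-back σ-algebra therefore
yields the same second moment as conditioning on all edges not containing `u`, and in `L²` this
forces the two conditional expectations to agree (`MeasurePreserving.condExp_ae_eq`). So, given the
lower ranks, the colour of `u` is independent of all other colours of rank `i`. -/

/-- Conditional expectations under an image measure are computed on the source. -/
theorem condExp_map_comp_ae_eq {m : MeasurableSpace Ω'} {mΩ : MeasurableSpace Ω}
    {mΩ' : MeasurableSpace Ω'} {P : Measure Ω} [IsFiniteMeasure P] {Φ : Ω → Ω'}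
    (hΦ : Measurable Φ) (hm : m ≤ mΩ') {f : Ω' → ℝ}
    (hf : Integrable f (P.map Φ)) :
    ((P.map Φ)[f | m]) ∘ Φ =ᵐ[P] P[f ∘ Φ | m.comap Φ] := by
  have hle : m.comap Φ ≤ mΩ := (MeasurableSpace.comap_mono hm).trans hΦ.comap_le
  have hint : Integrable ((P.map Φ)[f | m]) (P.map Φ) := integrable_condExp
  refine ae_eq_condExp_of_forall_setIntegral_eq hle (hf.comp_measurable hΦ)
    (fun _ _ _ => (hint.comp_measurable hΦ).integrableOn) ?_ ?_
  · rintro _ ⟨t, ht, rfl⟩ -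
    have h1 := setIntegral_map (μ := P) (hm t ht) hint.aestronglyMeasurable hΦ.aemeasurable
    have h2 := setIntegral_map (μ := P) (hm t ht) hf.aestronglyMeasurable hΦ.aemeasurable
    exact h1.symm.trans ((setIntegral_condExp hm hf ht).trans h2)
  · exact (stronglyMeasurable_condExp.comp_measurable
      (comap_measurable Φ)).aestronglyMeasurable

/-- The conditional expectation of a bounded function on a smaller σ-algebra agrees with the one
on a larger σ-algebra as soon as the two have the same second moment. -/
theorem condExp_ae_eq_of_integral_sq_eq {m₁ m₂ mΩ : MeasurableSpace Ω} {P : Measure Ω}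
    [IsFiniteMeasure P] (h₁₂ : m₁ ≤ m₂) (h₂ : m₂ ≤ mΩ) {f : Ω → ℝ} {R : ℝ}
    (hf : ∀ᵐ x ∂P, |f x| ≤ R)
    (hsq : ∫ x, (P[f | m₁]) x ^ 2 ∂P = ∫ x, (P[f | m₂]) x ^ 2 ∂P) :
    P[f | m₂] =ᵐ[P] P[f | m₁] := by
  set g := P[f | m₁] with hg
  set h := P[f | m₂] with hh
  have hgb : ∀ᵐ x ∂P, |g x| ≤ R := ae_bdd_abs_condExp_of_ae_bdd_abs hf
  have hhb : ∀ᵐ x ∂P, |h x| ≤ R := ae_bdd_abs_condExp_of_ae_bdd_abs hf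
  have hgi : Integrable g P := integrable_condExp
  have hhi : Integrable h P := integrable_condExp
  have hgg : Integrable (g * g) P := hgi.bdd_mul hgi.aestronglyMeasurable hgb
  have hhh : Integrable (h * h) P := hhi.bdd_mul hhi.aestronglyMeasurable hhb
  have hgh : Integrable (g * h) P := hhi.bdd_mul hgi.aestronglyMeasurable hgb
  -- `g` is `m₁`-measurable and is the projection of `h` to `m₁`, so `h - g` is orthogonal to `g`.
  have hcross : ∫ x, (g * h) x ∂P = ∫ x, (g * g) x ∂P := by
    rw [← integral_condExp (h₁₂.trans h₂)]
    refine integral_congr_ae ?_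
    refine (condExp_mul_of_stronglyMeasurable_left stronglyMeasurable_condExp hgh hhi).trans ?_
    filter_upwards [condExp_condExp_of_le (μ := P) (f := f) h₁₂ h₂] with x hx
    simp only [Pi.mul_apply]
    rw [hh, hx]
  have hzero : ∫ x, (h x - g x) ^ 2 ∂P = 0 := by
    have : (fun x => (h x - g x) ^ 2) = fun x => ((h * h) x - 2 * (g * h) x) + (g * g) x := by
      funext x
      simp only [Pi.mul_apply]
      ring
    rw [this, integral_add (f := fun x => (h * h) x - 2 * (g * h) x) (hhh.sub (hgh.const_mul 2)) hgg,
      integral_sub hhh (hgh.const_mul 2), integral_const_mul, hcross]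
    have e₁ : ∫ x, (g * g) x ∂P = ∫ x, g x ^ 2 ∂P := by simp only [Pi.mul_apply, sq]
    have e₂ : ∫ x, (h * h) x ∂P = ∫ x, h x ^ 2 ∂P := by simp only [Pi.mul_apply, sq]
    rw [e₁, e₂, hsq]
    ring
  have hint : Integrable (fun x => (h x - g x) ^ 2) P := by
    have : (fun x => (h x - g x) ^ 2) = h * h - (2 : ℝ) • (g * h) + g * g := by
      funext x
      simp only [Pi.mul_apply, Pi.add_apply, Pi.sub_apply, Pi.smul_apply, smul_eq_mul]
      ring
    rw [this]
    exact (hhh.sub (hgh.smul 2)).add hgg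
  rw [integral_eq_zero_iff_of_nonneg (fun x => sq_nonneg _) hint] at hzero
  filter_upwards [hzero] with x hx
  exact sub_eq_zero.1 (pow_eq_zero_iff two_ne_zero |>.1 hx)

/-- If a measure-preserving map fixes a bounded function and pulls the σ-algebra `m` back into
`m' ≤ m`, then conditioning this function on `m` is the same as conditioning it on `m'`. -/
theorem MeasurePreserving.condExp_ae_eq {m m' mΩ : MeasurableSpace Ω} {P : Measure Ω}
    [IsFiniteMeasure P] {φ : Ω → Ω} (hφ : MeasurePreserving φ P P) (hm : m ≤ mΩ) (hm' : m' ≤ m)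
    (hcomap : m.comap φ ≤ m') {f : Ω → ℝ} (hf : Integrable f P) {R : ℝ}
    (hR : ∀ᵐ x ∂P, |f x| ≤ R) (hinv : f ∘ φ = f) :
    P[f | m] =ᵐ[P] P[f | m'] := by
  have hle : m.comap φ ≤ m := hcomap.trans hm'
  -- By invariance of `f`, the right side is `P[f | m] ∘ φ`, which has the same second moment as
  -- `P[f | m]`.
  have key : P[f | m] =ᵐ[P] P[f | m.comap φ] := by
    refine condExp_ae_eq_of_integral_sq_eq hle hm hR ?_
    have h := condExp_map_comp_ae_eq hφ.measurable hm (by rwa [hφ.map_eq])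
    rw [hφ.map_eq, hinv] at h
    have h2 : ∫ x, (P[f | m.comap φ]) x ^ 2 ∂P = ∫ x, (P[f | m]) (φ x) ^ 2 ∂P := by
      refine integral_congr_ae ?_
      filter_upwards [h] with x hx
      rw [← hx, Function.comp_apply]
    rw [h2]
    have h3 := integral_map (μ := P) hφ.measurable.aemeasurable
      (f := fun x => (P[f | m]) x ^ 2)
      (by
        rw [hφ.map_eq]
        exact ((stronglyMeasurable_condExp.mono hm).pow 2).aestronglyMeasurable)
    rw [hφ.map_eq] at h3
    exact h3.symm
  -- `m'` lies between `m.comap φ` and `m`: by `key`, `P[f | m]` is already `m'`-measurable up to a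
  -- null set, so projecting it to `m'` changes nothing.
  have h1 : P[P[f | m] | m'] =ᵐ[P] P[f | m'] := condExp_condExp_of_le hm' hm
  have h2 : P[P[f | m] | m'] =ᵐ[P] P[P[f | m.comap φ] | m'] := condExp_congr_ae key
  have h3 : P[P[f | m.comap φ] | m'] = P[f | m.comap φ] :=
    condExp_of_stronglyMeasurable (hm'.trans hm) (stronglyMeasurable_condExp.mono hcomap)
      integrable_condExp
  rw [h3] at h2
  exact key.trans (h2.symm.trans h1)

end MeasureTheory

/-! ### A criterion for conditional independence. -/

namespace ProbabilityTheory

variable {Ω ι : Type*}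

/-- Conditional independence given `m'` of a family of σ-algebras, each of which is conditionally
independent given `m'` of a σ-algebra containing all the others. -/
theorem iCondIndep_of_condExp_ae_eq {m' mΩ : MeasurableSpace Ω} [StandardBorelSpace Ω]
    {P : Measure Ω} [IsFiniteMeasure P] (hm' : m' ≤ mΩ) (m : ι → MeasurableSpace Ω) (hm : ∀ i, m i ≤ mΩ)
    (π : ι → Set (Set Ω)) (hπ : ∀ i, IsPiSystem (π i))
    (hgen : ∀ i, m i = MeasurableSpace.generateFrom (π i))
    (G : ι → MeasurableSpace Ω) (hG : ∀ i, G i ≤ mΩ) (hG' : ∀ i, m' ≤ G i)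
    (hmG : ∀ i j, j ≠ i → m j ≤ G i)
    (h : ∀ i, ∀ s ∈ π i, P⟦s | G i⟧ =ᵐ[P] P⟦s | m'⟧) :
    iCondIndep m' hm' m P := by
  have hπm : ∀ i, ∀ s ∈ π i, MeasurableSet[m i] s := fun i s hs => by
    rw [hgen i]
    exact MeasurableSpace.measurableSet_generateFrom hs
  refine iCondIndepSets.iCondIndep m hm π hπ hgen ?_
  rw [iCondIndepSets_iff _ _ _ (fun i s hs => hm i s (hπm i s hs))]
  intro s f hf
  classical
  induction s using Finset.induction_on with
  | empty =>
    simp only [Finset.notMem_empty, Set.iInter_of_empty, Set.iInter_univ, Finset.prod_empty,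
      Set.indicator_univ]
    rw [condExp_const hm']
    rfl
  | insert a s ha ih =>
    have ih := ih fun i hi => hf i (Finset.mem_insert_of_mem hi)
    have hfa := hf a (Finset.mem_insert_self a s)
    rw [Finset.set_biInter_insert, Finset.prod_insert ha]
    set A := f a
    set B := ⋂ i ∈ s, f i
    have hAm : MeasurableSet A := hm a _ (hπm a _ hfa)
    have hBG : MeasurableSet[G a] B := Finset.measurableSet_biInter s fun i hi =>
      hmG a i (fun e => ha (e ▸ hi)) _ (hπm i _ (hf i (Finset.mem_insert_of_mem hi)))
    set oneA : Ω → ℝ := A.indicator fun _ => 1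
    set oneB : Ω → ℝ := B.indicator fun _ => 1
    have hAint : Integrable oneA P := (integrable_const 1).indicator hAm
    have hBint : Integrable oneB P := (integrable_const 1).indicator (hG a _ hBG)
    have hAB : ((A ∩ B).indicator fun _ => (1 : ℝ)) = oneA * oneB := by
      funext x
      by_cases hA : x ∈ A <;> by_cases hB : x ∈ B <;> simp [oneA, oneB, hA, hB]
    have hBbd : ∀ x, |oneB x| ≤ 1 := fun x => by
      by_cases hx : x ∈ B <;> simp [oneB, hx]
    have hABint : Integrable (oneA * oneB) P := by
      rw [← hAB]
      exact (integrable_const 1).indicator (hAm.inter (hG a _ hBG))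
    -- `B` is known to `G a`, so it factors out, and conditioning `A` on `G a` reduces to `m'`. The
    -- tower property then splits the product given `m'`.
    have h1 : P[oneA * oneB | G a] =ᵐ[P] P[oneA | m'] * oneB :=
      (condExp_mul_of_stronglyMeasurable_right
        (stronglyMeasurable_const.indicator hBG) hABint hAint).trans
        ((h a _ hfa).mul Filter.EventuallyEq.rfl)
    have hint : Integrable (P[oneA | m'] * oneB) P :=
      integrable_condExp.mul_bdd (c := 1) hBint.aestronglyMeasurable (ae_of_all _ hBbd)
    calc P[(A ∩ B).indicator fun _ => (1 : ℝ) | m']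
        = P[oneA * oneB | m'] := by rw [hAB]
      _ =ᵐ[P] P[P[oneA * oneB | G a] | m'] := (condExp_condExp_of_le (hG' a) (hG a)).symm
      _ =ᵐ[P] P[P[oneA | m'] * oneB | m'] := condExp_congr_ae h1
      _ =ᵐ[P] P[oneA | m'] * P[oneB | m'] :=
        condExp_mul_of_stronglyMeasurable_left stronglyMeasurable_condExp hint hBint
      _ =ᵐ[P] P[oneA | m'] * ∏ i ∈ s, P⟦f i | m'⟧ := Filter.EventuallyEq.rfl.mul ih

end ProbabilityTheory

/-! ### Exchangeability and the unique extension. -/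

namespace Exch

/-- Two embeddings into `S` differ on a finite set by a finitely supported permutation of `S`. -/
theorem exists_perm_comp_eq {S T : Type*} (f g : T ↪ S) (F : Finset T) :
    ∃ σ : Equiv.Perm S, {s | σ s ≠ s}.Finite ∧ ∀ t ∈ F, σ (f t) = g t := by
  classical
  let A : Finset S := F.map f ∪ F.map g
  let f' : F → A := fun t => ⟨f t, Finset.mem_union_left _ (Finset.mem_map_of_mem f t.2)⟩
  let g' : F → A := fun t => ⟨g t, Finset.mem_union_right _ (Finset.mem_map_of_mem g t.2)⟩
  have hf : Function.Injective f' := fun a b h =>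
    Subtype.ext (f.injective (congrArg Subtype.val h))
  have hg : Function.Injective g' := fun a b h =>
    Subtype.ext (g.injective (congrArg Subtype.val h))
  -- The partial bijection `f t ↦ g t` of the finite set `A` extends to a permutation of `A`, then
  -- by the identity to `S`.
  let e : {a // a ∈ Set.range f'} ≃ {a // a ∈ Set.range g'} :=
    (Equiv.ofInjective f' hf).symm.trans (Equiv.ofInjective g' hg)
  let τ : Equiv.Perm A := e.extendSubtype
  have hτ : ∀ t : F, τ (f' t) = g' t := fun t => by
    have h := e.extendSubtype_apply_of_mem (f' t) ⟨t, rfl⟩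
    refine h.trans ?_
    have : (Equiv.ofInjective f' hf).symm ⟨f' t, ⟨t, rfl⟩⟩ = t :=
      Equiv.ofInjective_symm_apply hf t
    simp only [e, Equiv.trans_apply, this]
    rfl
  refine ⟨Equiv.Perm.ofSubtype τ, A.finite_toSet.subset fun s hs => ?_, fun t ht => ?_⟩
  · by_contra h
    exact hs (Equiv.Perm.ofSubtype_apply_of_not_mem τ h)
  · have h := Equiv.Perm.ofSubtype_apply_of_mem τ (f' ⟨t, ht⟩).2
    exact h.trans (congrArg Subtype.val (hτ ⟨t, ht⟩))

section Pullback

variable {k : ℕ} {K : Fin (k + 1) → Type u} {S T U : Type*}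

theorem pullback_pullback (f : S ↪ T) (g : T ↪ U) (ω : Hypergraph K U) :
    pullback f (pullback g ω) = pullback (f.trans g) ω := by
  funext i e
  simp only [pullback]
  congr 1
  exact Subtype.ext (Finset.map_map _ _ _)

theorem pullback_refl : (pullback (Function.Embedding.refl S) : Hypergraph K S → _) = id := by
  funext ω i e
  simp only [pullback, id]
  congr 1
  exact Subtype.ext Finset.map_refl

variable [∀ i, MeasurableSpace (K i)]

theorem measurable_pullback (f : S ↪ T) :
    Measurable (pullback f : Hypergraph K T → Hypergraph K S) :=
  measurable_pi_lambda _ fun i => measurable_pi_lambda _ fun e =>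
    (measurable_pi_apply (Set.powersetCard.map (i : ℕ) f e)).comp (measurable_pi_apply i)

theorem map_pullback_map (μ : Measure (Hypergraph K U)) (f : S ↪ T) (g : T ↪ U) :
    (μ.map (pullback g)).map (pullback f) = μ.map (pullback (f.trans g)) := by
  rw [Measure.map_map (measurable_pullback f) (measurable_pullback g)]
  congr 1
  funext ω
  exact pullback_pullback f g ω

/-- The measurable sets of hypergraphs that depend only on the edges inside some finite set of
vertices. -/
def localSets (K : Fin (k + 1) → Type u) [∀ i, MeasurableSpace (K i)] (S : Type*) :
    Set (Set (Hypergraph K S)) :=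
  {s | MeasurableSet s ∧ ∃ F : Finset S, ∀ x y : Hypergraph K S,
    (∀ (i : Fin (k + 1)) (e : Set.powersetCard S (i : ℕ)), e.1 ⊆ F → x i e = y i e) → (x ∈ s ↔ y ∈ s)}

theorem isPiSystem_localSets : IsPiSystem (localSets K S) := by
  classical
  rintro s ⟨hs, F, hF⟩ t ⟨ht, G, hG⟩ -
  refine ⟨hs.inter ht, F ∪ G, fun x y h => and_congr (hF x y fun i e he => ?_)
    (hG x y fun i e he => ?_)⟩
  · exact h i e (he.trans Finset.subset_union_left)
  · exact h i e (he.trans Finset.subset_union_right)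

theorem generateFrom_localSets :
    MeasurableSpace.generateFrom (localSets K S) =
      (inferInstance : MeasurableSpace (Hypergraph K S)) := by
  refine le_antisymm (MeasurableSpace.generateFrom_le fun s hs => hs.1) ?_
  refine iSup_le fun i => ?_
  rw [MeasurableSpace.comap_le_iff_le_map]
  refine iSup_le fun e => ?_
  rintro _ ⟨B, hB, rfl⟩
  refine MeasurableSpace.measurableSet_generateFrom ⟨?_, e.1, fun x y h => ?_⟩
  · exact (measurable_pi_apply i) ((measurable_pi_apply e) hB)
  · simp only [Set.mem_preimage, h i e subset_rfl]

/-- The law of the hypergraph induced from an exchangeable one by an injection of vertices does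
not depend on the injection. -/
theorem IsExchangeable.map_pullback_eq {μ : Measure (Hypergraph K S)} [IsProbabilityMeasure μ]
    (hμ : IsExchangeable μ) (f g : T ↪ S) : μ.map (pullback f) = μ.map (pullback g) := by
  have := Measure.isProbabilityMeasure_map (μ := μ) (measurable_pullback (K := K) f).aemeasurable
  have := Measure.isProbabilityMeasure_map (μ := μ) (measurable_pullback (K := K) g).aemeasurable
  refine ext_of_generate_finite (localSets K T) generateFrom_localSets.symm isPiSystem_localSets
    ?_ (by simp)
  rintro s ⟨hs, F, hF⟩
  obtain ⟨σ, hσ, hσF⟩ := exists_perm_comp_eq f g F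
  -- The permutation enters on both sides; it is absorbed into `f` on the left and removed again on
  -- the right. On `F` the composite agrees with `g`.
  rw [← hμ σ hσ, map_pullback_map, Measure.map_apply (measurable_pullback _) hs,
    hμ σ hσ, Measure.map_apply (measurable_pullback _) hs]
  congr 1
  ext ω
  refine hF _ _ fun i e he => ?_
  simp only [pullback]
  congr 1
  refine Subtype.ext ?_
  simp only [Set.powersetCard.val_map]
  ext x
  simp only [Finset.mem_map, Function.Embedding.trans_apply, Equiv.coe_toEmbedding]
  exact exists_congr fun t => and_congr_right fun ht => by rw [hσF t (he ht)]

/-- A law on `T`-hypergraphs induced from an exchangeable one is exchangeable. -/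
theorem IsExchangeable.map_pullback {μ : Measure (Hypergraph K S)} [IsProbabilityMeasure μ]
    (hμ : IsExchangeable μ) (f : T ↪ S) : IsExchangeable (μ.map (pullback f)) := fun g _ => by
  rw [map_pullback_map]
  exact hμ.map_pullback_eq _ _

theorem IsExchangeable.existsUnique_extension [Countable S] [Infinite S] [Countable T]
    {μ : Measure (Hypergraph K S)} [IsProbabilityMeasure μ] (hμ : IsExchangeable μ) :
    ∃! μ' : Measure (Hypergraph K (S ⊕ T)), IsExchangeableExtension μ μ' := by
  obtain ⟨a, ha⟩ := exists_injective_nat (S ⊕ T)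
  let j : S ⊕ T ↪ S := (⟨a, ha⟩ : S ⊕ T ↪ ℕ).trans (Infinite.natEmbedding S)
  refine ⟨μ.map (pullback j), ⟨?_, hμ.map_pullback j, ?_⟩, ?_⟩
  · exact Measure.isProbabilityMeasure_map (measurable_pullback j).aemeasurable
  · rw [map_pullback_map, hμ.map_pullback_eq _ (Function.Embedding.refl S), pullback_refl,
      Measure.map_id]
  -- For any extension, inducing along `j` followed by `inl` is inducing along a self-injection of
  -- `S ⊕ T`, which returns `μ'`.
  · rintro μ' ⟨h1, h2, rfl⟩
    rw [map_pullback_map, h2.map_pullback_eq _ (Function.Embedding.refl _), pullback_refl,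
      Measure.map_id]

end Pullback

end Exch

/-! ### Internalization and its combinatorics. -/

namespace Exch

section Internal

variable {k : ℕ} {K : Fin (k + 1) → Type u} {S₁ : Type v} {S₂ : Type w}

/-- For finite `u ⊆ S₁` and `T ⊆ S₂` there is an injection of `S₁ ∪ S₂` into itself that fixes
`u ∪ T` and moves every other vertex into `S₂`. -/
theorem exists_embedding_fixing [Countable S₁] [Countable S₂] [Infinite S₂]
    (u : Finset S₁) (T : Finset S₂) :
    ∃ ψ : S₁ ⊕ S₂ ↪ S₁ ⊕ S₂, (∀ x ∈ u.disjSum T, ψ x = x) ∧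
      ∀ x y, ψ x = Sum.inl y → x = Sum.inl y ∧ y ∈ u := by
  classical
  obtain ⟨a, ha⟩ := exists_injective_nat (S₁ ⊕ S₂)
  have : Infinite {t : S₂ // t ∉ T} := by
    have h := T.finite_toSet.infinite_compl
    exact Set.infinite_coe_iff.2 h
  let ρ : S₁ ⊕ S₂ ↪ {t : S₂ // t ∉ T} :=
    (⟨a, ha⟩ : S₁ ⊕ S₂ ↪ ℕ).trans (Infinite.natEmbedding _)
  -- `ρ` avoids `T`, so moved vertices never collide with fixed ones.
  let ψ : S₁ ⊕ S₂ → S₁ ⊕ S₂ := fun x => if x ∈ u.disjSum T then x else Sum.inr (ρ x)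
  have hmem : ∀ x, Sum.inr (ρ x : S₂) ∉ u.disjSum T := fun x h =>
    (ρ x).2 (Finset.inr_mem_disjSum.1 h)
  have hψ : Function.Injective ψ := fun x y h => by
    simp only [ψ] at h
    split_ifs at h with hx hy hy
    · exact h
    · exact absurd (h ▸ hx) (hmem y)
    · exact absurd (h ▸ hy) (hmem x)
    · exact ρ.injective (Subtype.ext (Sum.inr_injective h))
  refine ⟨⟨ψ, hψ⟩, fun x hx => if_pos hx, fun x y h => ?_⟩
  have h' : (if x ∈ u.disjSum T then x else Sum.inr (ρ x)) = Sum.inl y := h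
  split_ifs at h' with hx
  exact ⟨h', Finset.inl_mem_disjSum.1 (h' ▸ hx)⟩

/-- Every edge of `S₁ ∪ S₂` is read off from the internalized hypergraph at its trace on `S₁`. -/
theorem exists_internalize_eq (j : Fin (k + 1)) (e : Set.powersetCard (S₁ ⊕ S₂) (j : ℕ)) :
    ∃ (i : Fin (k + 1)) (hij : i ≤ j) (u : Set.powersetCard S₁ (i : ℕ))
      (w : Set.powersetCard S₂ ((j : ℕ) - (i : ℕ))), u.1 = e.1.toLeft ∧
        ∀ ω : Hypergraph K (S₁ ⊕ S₂), internalize ω i u ⟨j, hij⟩ w = ω j e := by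
  have hcard : e.1.toLeft.card + e.1.toRight.card = j :=
    Finset.card_toLeft_add_card_toRight.trans (Set.powersetCard.card_eq e)
  have hle : e.1.toLeft.card ≤ j := by omega
  refine ⟨⟨e.1.toLeft.card, by omega⟩, hle, ⟨e.1.toLeft, rfl⟩, ⟨e.1.toRight, ?_⟩, rfl,
    fun ω => ?_⟩
  · rw [Set.powersetCard.mem_iff]
    exact Nat.eq_sub_of_add_eq' hcard
  · simp only [internalize]
    congr 1
    exact Subtype.ext Finset.toLeft_disjSum_toRight

/-- Only edges `u ∪ w` with `w ⊆ T` matter for `D`, and `ψ` fixes all their vertices. -/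
theorem internalize_pullback_mem_iff {i : Fin (k + 1)} (u : Set.powersetCard S₁ (i : ℕ))
    {ψ : S₁ ⊕ S₂ ↪ S₁ ⊕ S₂} {T : Finset S₂} (hψ : ∀ x ∈ u.1.disjSum T, ψ x = x)
    {D : Set (internalPalette K S₂ i)}
    (hD : ∀ x y : internalPalette K S₂ i,
      (∀ (j : {j : Fin (k + 1) // i ≤ j}) (w : Set.powersetCard S₂ ((j.1 : ℕ) - (i : ℕ))),
        w.1 ⊆ T → x j w = y j w) → (x ∈ D ↔ y ∈ D)) (ω : Hypergraph K (S₁ ⊕ S₂)) :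
    internalize (pullback ψ ω) i u ∈ D ↔ internalize ω i u ∈ D := by
  refine hD _ _ fun j w hw => ?_
  simp only [internalize, pullback]
  congr 1
  refine Subtype.ext ?_
  simp only [Set.powersetCard.val_map, joinEdge, Set.powersetCard.val_ofCard]
  have hfix : ∀ x ∈ u.1.disjSum w.1, ψ x = x := fun x hx =>
    hψ x (Finset.disjSum_mono subset_rfl hw hx)
  ext x
  rw [Finset.mem_map]
  constructor
  · rintro ⟨y, hy, rfl⟩
    rwa [hfix y hy]
  · exact fun hx => ⟨x, hx, hfix x hx⟩

/-- The colour of the edges of size `i` inside `S₁`, as a function of their internal colours. -/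
def uncolor (K : Fin (k + 1) → Type u) (S₂ : Type w) (i : Fin (k + 1))
    (z : internalPalette K S₂ i) : K i :=
  z ⟨i, le_rfl⟩ (Set.powersetCard.ofCard (s := ∅) (by simp))

theorem power_uncolor_internalize (ω : Hypergraph K (S₁ ⊕ S₂)) :
    power (uncolor K S₂) S₁ (internalize ω) = pullback Function.Embedding.inl ω := by
  funext i e
  simp only [power, uncolor, internalize, pullback]
  congr 1
  refine Subtype.ext ?_
  simp only [Set.powersetCard.val_map, joinEdge, Set.powersetCard.val_ofCard]
  exact Finset.disjSum_empty _

/-! ### Conditional independence of internal colours. -/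

section Measurable

variable [∀ i, MeasurableSpace (K i)]

theorem measurable_internalize :
    Measurable (internalize : Hypergraph K (S₁ ⊕ S₂) → Hypergraph (internalPalette K S₂) S₁) :=
  measurable_pi_lambda _ fun _ => measurable_pi_lambda _ fun u => measurable_pi_lambda _ fun j =>
    measurable_pi_lambda _ fun w =>
      (measurable_pi_apply (joinEdge j.2 u w)).comp (measurable_pi_apply j.1)

/-- The σ-algebra generated by the colours of all edges that do not contain `u`. -/
@[reducible] def avoiding {k : ℕ} (Z : Fin (k + 1) → Type*) [∀ i, MeasurableSpace (Z i)]
    {S : Type*} (u : Finset S) : MeasurableSpace (Hypergraph Z S) :=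
  ⨆ (j : Fin (k + 1)) (e : Set.powersetCard S (j : ℕ)) (_ : ¬ u ⊆ e.1),
    MeasurableSpace.comap (fun ω : Hypergraph Z S => ω j e) inferInstance

theorem comap_eval_le_avoiding {Z : Fin (k + 1) → Type*} [∀ i, MeasurableSpace (Z i)]
    {S : Type*} {u : Finset S} {j : Fin (k + 1)} (e : Set.powersetCard S (j : ℕ))
    (h : ¬ u ⊆ e.1) :
    MeasurableSpace.comap (fun ω : Hypergraph Z S => ω j e) inferInstance ≤ avoiding Z u :=
  le_iSup_of_le j (le_iSup_of_le e (le_iSup_of_le h le_rfl))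

theorem comap_eval_le_lowerRank {Z : Fin (k + 1) → Type*} [∀ i, MeasurableSpace (Z i)]
    {S : Type*} {i j : Fin (k + 1)} (h : j < i) (e : Set.powersetCard S (j : ℕ)) :
    MeasurableSpace.comap (fun ω : Hypergraph Z S => ω j e) inferInstance ≤ lowerRank Z S i :=
  le_iSup_of_le j (le_iSup_of_le h (le_iSup_of_le e le_rfl))

theorem avoiding_le {Z : Fin (k + 1) → Type*} [∀ i, MeasurableSpace (Z i)]
    {S : Type*} (u : Finset S) :
    avoiding Z u ≤ (inferInstance : MeasurableSpace (Hypergraph Z S)) := by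
  refine iSup_le fun j => iSup_le fun e => iSup_le fun _ => Measurable.comap_le ?_
  exact (measurable_pi_apply e).comp (measurable_pi_apply j)

theorem lowerRank_le_avoiding {Z : Fin (k + 1) → Type*} [∀ i, MeasurableSpace (Z i)]
    {S : Type*} {i : Fin (k + 1)} (u : Set.powersetCard S (i : ℕ)) :
    lowerRank Z S i ≤ avoiding Z u.1 := by
  refine iSup_le fun j => iSup_le fun hj => iSup_le fun e => comap_eval_le_avoiding e fun h => ?_
  have hcard := Finset.card_le_card h
  rw [Set.powersetCard.card_eq, Set.powersetCard.card_eq] at hcard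
  exact absurd hj (not_lt.2 hcard)

/-- The measurable sets of internal colours that depend only on the edges whose `S₂`-part lies in
some finite set of vertices. -/
def localColorSets (K : Fin (k + 1) → Type u) [∀ i, MeasurableSpace (K i)] (S₂ : Type w)
    (i : Fin (k + 1)) : Set (Set (internalPalette K S₂ i)) :=
  {D | MeasurableSet D ∧ ∃ T : Finset S₂, ∀ x y : internalPalette K S₂ i,
    (∀ (j : {j : Fin (k + 1) // i ≤ j}) (w : Set.powersetCard S₂ ((j.1 : ℕ) - (i : ℕ))),
      w.1 ⊆ T → x j w = y j w) → (x ∈ D ↔ y ∈ D)}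

theorem isPiSystem_localColorSets (i : Fin (k + 1)) : IsPiSystem (localColorSets K S₂ i) := by
  classical
  rintro s ⟨hs, F, hF⟩ t ⟨ht, G, hG⟩ -
  refine ⟨hs.inter ht, F ∪ G, fun x y h => and_congr (hF x y fun j w hw => ?_)
    (hG x y fun j w hw => ?_)⟩
  · exact h j w (hw.trans Finset.subset_union_left)
  · exact h j w (hw.trans Finset.subset_union_right)

theorem generateFrom_localColorSets (i : Fin (k + 1)) :
    MeasurableSpace.generateFrom (localColorSets K S₂ i) =
      (inferInstance : MeasurableSpace (internalPalette K S₂ i)) := by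
  refine le_antisymm (MeasurableSpace.generateFrom_le fun s hs => hs.1) ?_
  refine iSup_le fun j => ?_
  rw [MeasurableSpace.comap_le_iff_le_map]
  refine iSup_le fun w => ?_
  rintro _ ⟨B, hB, rfl⟩
  refine MeasurableSpace.measurableSet_generateFrom ⟨?_, w.1, fun x y h => ?_⟩
  · exact (measurable_pi_apply j) ((measurable_pi_apply w) hB)
  · simp only [Set.mem_preimage, h j w subset_rfl]

/-- Pulling back along an injection that moves all vertices outside of `u ∪ T` into `S₂` turns the
colours of internal edges not containing `u` into colours of internal edges of smaller size. -/
theorem comap_pullback_avoiding_le {i : Fin (k + 1)} (u : Set.powersetCard S₁ (i : ℕ))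
    {ψ : S₁ ⊕ S₂ ↪ S₁ ⊕ S₂} (hψ : ∀ x y, ψ x = Sum.inl y → x = Sum.inl y ∧ y ∈ u.1) :
    ((avoiding (internalPalette K S₂) u.1).comap internalize).comap
      (pullback ψ : Hypergraph K (S₁ ⊕ S₂) → _) ≤
      (lowerRank (internalPalette K S₂) S₁ i).comap internalize := by
  have hm : ∀ i' : Fin (k + 1), i' < i → ∀ u' : Set.powersetCard S₁ (i' : ℕ),
      @Measurable _ _ ((lowerRank (internalPalette K S₂) S₁ i).comap internalize) _
        (fun ω : Hypergraph K (S₁ ⊕ S₂) => internalize ω i' u') := fun i' hlt u' =>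
    (Measurable.of_comap_le (comap_eval_le_lowerRank hlt u')).comp (comap_measurable internalize)
  -- Making the target opaque keeps the following `simp only` from expanding it too.
  generalize (lowerRank (internalPalette K S₂) S₁ i).comap internalize = m₀ at hm ⊢
  simp only [avoiding, MeasurableSpace.comap_iSup, MeasurableSpace.comap_comp]
  refine iSup_le fun j => iSup_le fun e => iSup_le fun he => Measurable.comap_le ?_
  refine measurable_pi_lambda _ fun l => measurable_pi_lambda _ fun w => ?_
  obtain ⟨i', hi', u', w', hu', h⟩ := exists_internalize_eq (K := K) l.1
    (Set.powersetCard.map (l.1 : ℕ) ψ (joinEdge l.2 e w))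
  -- The trace on `S₁` of the moved edge lies in `u ∩ e`, a proper subset of `u` since `e` does not
  -- contain `u`.
  have hlt : i' < i := by
    have hss : u'.1 ⊂ u.1 := by
      have hmem : ∀ y ∈ u'.1, y ∈ u.1 ∧ y ∈ e.1 := fun y hy => by
        rw [hu', Finset.mem_toLeft, Set.powersetCard.val_map, Finset.mem_map] at hy
        obtain ⟨x, hx, hxy⟩ := hy
        obtain ⟨rfl, hyu⟩ := hψ x y hxy
        exact ⟨hyu, Finset.inl_mem_disjSum.1 hx⟩
      refine (Finset.ssubset_iff_subset_ne).2 ⟨fun y hy => (hmem y hy).1, fun heq => ?_⟩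
      exact he fun y hy => (hmem y (heq ▸ hy)).2
    have hcard := Finset.card_lt_card hss
    rwa [Set.powersetCard.card_eq, Set.powersetCard.card_eq] at hcard
  have hfun : (fun ω : Hypergraph K (S₁ ⊕ S₂) => internalize (pullback ψ ω) j e l w) =
      (fun z : internalPalette K S₂ i' => z ⟨l.1, hi'⟩ w') ∘ fun ω => internalize ω i' u' := by
    funext ω
    exact (h ω).symm
  exact hfun ▸ ((measurable_pi_apply w').comp (measurable_pi_apply _)).comp (hm i' hlt u')

/-- In the internalization of an exchangeable hypergraph, the colour of `u` is conditionally
independent, given the colours of the smaller edges, of all edges not containing `u`. -/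
theorem condExp_internalize_ae_eq [Countable S₁] [Countable S₂] [Infinite S₂]
    {P : Measure (Hypergraph K (S₁ ⊕ S₂))} [IsProbabilityMeasure P] (hP : IsExchangeable P)
    {i : Fin (k + 1)} (u : Set.powersetCard S₁ (i : ℕ)) {D : Set (internalPalette K S₂ i)}
    (hD : D ∈ localColorSets K S₂ i) :
    (P.map internalize)[((fun ω => ω i u) ⁻¹' D).indicator (fun _ => (1 : ℝ)) |
        avoiding (internalPalette K S₂) u.1] =ᵐ[P.map internalize]
      (P.map internalize)[((fun ω => ω i u) ⁻¹' D).indicator (fun _ => (1 : ℝ)) |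
        lowerRank (internalPalette K S₂) S₁ i] := by
  obtain ⟨hDm, T, hDT⟩ := hD
  obtain ⟨ψ, hfix, hψ⟩ := exists_embedding_fixing u.1 T
  have hφ : MeasurePreserving (pullback ψ) P P :=
    ⟨measurable_pullback ψ, by
      rw [hP.map_pullback_eq ψ (Function.Embedding.refl _), pullback_refl, Measure.map_id]⟩
  have hΦ := measurable_internalize (K := K) (S₁ := S₁) (S₂ := S₂)
  set B : Set (Hypergraph (internalPalette K S₂) S₁) := (fun ω => ω i u) ⁻¹' D with hB
  have hBm : MeasurableSet B := ((measurable_pi_apply u).comp (measurable_pi_apply i)) hDm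
  set f : Hypergraph (internalPalette K S₂) S₁ → ℝ := B.indicator fun _ => 1 with hf
  have : IsProbabilityMeasure (P.map (internalize (S₁ := S₁) (S₂ := S₂))) :=
    Measure.isProbabilityMeasure_map hΦ.aemeasurable
  have hint : Integrable f (P.map internalize) := (integrable_const 1).indicator hBm
  have hbd : ∀ x, |f x| ≤ 1 := fun x => by by_cases hx : x ∈ B <;> simp [f, hx]
  have hinv : (f ∘ internalize) ∘ (pullback ψ : Hypergraph K (S₁ ⊕ S₂) → _) = f ∘ internalize := by
    funext ω
    have h := internalize_pullback_mem_iff u hfix hDT ω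
    classical
    simp only [Function.comp_apply, hf, Set.indicator_apply]
    exact if_congr h rfl rfl
  have key := hφ.condExp_ae_eq
    ((MeasurableSpace.comap_mono (avoiding_le u.1)).trans hΦ.comap_le)
    (MeasurableSpace.comap_mono (lowerRank_le_avoiding u))
    (comap_pullback_avoiding_le u hψ) (hint.comp_measurable hΦ) (R := 1)
    (ae_of_all _ fun ω => hbd _) hinv
  have h1 := condExp_map_comp_ae_eq hΦ (avoiding_le u.1) hint
  have h2 := condExp_map_comp_ae_eq hΦ (lowerRank_le _ S₁ i) hint
  have h3 := (h1.trans key).trans h2.symm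
  refine (ae_map_iff hΦ.aemeasurable ?_).2 h3
  exact measurableSet_eq_fun ((stronglyMeasurable_condExp.mono (avoiding_le u.1)).measurable)
    ((stronglyMeasurable_condExp.mono (lowerRank_le _ S₁ i)).measurable)

/-- In the internalization of an exchangeable hypergraph, the colours of the edges of size `i` are
conditionally independent given the colours of the smaller edges. -/
theorem iCondIndepFun_internalize [Countable S₁] [Countable S₂] [Infinite S₂]
    [StandardBorelSpace (Hypergraph (internalPalette K S₂) S₁)]
    {P : Measure (Hypergraph K (S₁ ⊕ S₂))} [IsProbabilityMeasure P] (hP : IsExchangeable P)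
    (i : Fin (k + 1)) :
    ProbabilityTheory.iCondIndepFun (lowerRank (internalPalette K S₂) S₁ i)
      (lowerRank_le _ S₁ i)
      (fun (e : Set.powersetCard S₁ (i : ℕ)) (ω : Hypergraph (internalPalette K S₂) S₁) => ω i e)
      (P.map internalize) := by
  rw [ProbabilityTheory.iCondIndepFun_iff_iCondIndep]
  refine ProbabilityTheory.iCondIndep_of_condExp_ae_eq (lowerRank_le _ S₁ i) _
    (fun u => Measurable.comap_le ((measurable_pi_apply u).comp (measurable_pi_apply i)))
    (fun u => Set.preimage (fun ω : Hypergraph (internalPalette K S₂) S₁ => ω i u) ''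
      localColorSets K S₂ i)
    (fun u => ?_) (fun u => ?_) (fun u => avoiding _ u.1) (fun u => avoiding_le u.1)
    (fun u => lowerRank_le_avoiding u) (fun u v huv => ?_) ?_
  · exact (isPiSystem_localColorSets i).comap _
  · rw [← MeasurableSpace.comap_generateFrom, generateFrom_localColorSets]
  -- Distinct sets of equal size do not contain one another.
  · exact comap_eval_le_avoiding v fun h => huv (Set.powersetCard.eq_iff_subset.2 h).symm
  · rintro u _ ⟨D, hD, rfl⟩
    exact condExp_internalize_ae_eq hP u hD

theorem measurable_power {Y : Fin (k + 1) → Type*} {Z : Fin (k + 1) → Type*}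
    [∀ i, MeasurableSpace (Y i)] [∀ i, MeasurableSpace (Z i)] {Λ : ∀ i, Y i → Z i}
    (hΛ : ∀ i, Measurable (Λ i)) (S : Type*) : Measurable (power Λ S) :=
  measurable_pi_lambda _ fun i => measurable_pi_lambda _ fun e =>
    (hΛ i).comp ((measurable_pi_apply e).comp (measurable_pi_apply i))

end Measurable

end Internal

/-! ### Embedding into the Cantor space, and the theorem. -/

/-- A compact space whose points are separated by countably many continuous maps to countable
discrete spaces is homeomorphic to a closed subset of the Cantor space. -/
theorem exists_isClosedEmbedding_cantor {X ι : Type*} [TopologicalSpace X] [CompactSpace X]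
    [Countable ι] {Y : ι → Type*} [∀ i, TopologicalSpace (Y i)] [∀ i, DiscreteTopology (Y i)]
    [∀ i, Countable (Y i)] (p : ∀ i, X → Y i) (hp : ∀ i, Continuous (p i))
    (hsep : ∀ x y, (∀ i, p i x = p i y) → x = y) :
    ∃ c : X → (ℕ → Bool), Topology.IsClosedEmbedding c := by
  classical
  obtain ⟨a, ha⟩ := exists_injective_nat (Σ i, Y i)
  -- The bit at `a ⟨i, b⟩` records whether `p i x = b`; bits outside the range of `a` are constantly
  -- `false`.
  let c : X → (ℕ → Bool) := fun x n => decide (∃ i, a ⟨i, p i x⟩ = n)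
  have hval : ∀ x i (b : Y i), c x (a ⟨i, b⟩) = decide (p i x = b) := fun x i b => by
    refine decide_eq_decide.2 ⟨?_, fun h => ⟨i, by rw [h]⟩⟩
    rintro ⟨j, hj⟩
    have h := ha hj
    obtain rfl : j = i := congrArg Sigma.fst h
    exact eq_of_heq (Sigma.mk.inj h).2
  have hcont : Continuous c := by
    refine continuous_pi fun n => ?_
    by_cases hn : ∃ q, a q = n
    · obtain ⟨⟨i, b⟩, rfl⟩ := hn
      simp only [hval]
      exact (continuous_of_discreteTopology (f := fun y : Y i => decide (y = b))).comp (hp i)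
    · have : ∀ x, c x n = false := fun x => decide_eq_false fun ⟨i, hi⟩ => hn ⟨_, hi⟩
      simp only [this]
      exact continuous_const
  refine ⟨c, hcont.isClosedEmbedding fun x y h => hsep x y fun i => ?_⟩
  have h1 := congrFun h (a ⟨i, p i x⟩)
  rw [hval, hval, decide_eq_decide] at h1
  exact (h1.1 rfl).symm

end Exch

theorem theorem3p17 {k : ℕ} (K : Fin (k + 1) → Type u) [∀ i, Finite (K i)]
    [∀ i, TopologicalSpace (K i)] [∀ i, DiscreteTopology (K i)]
    [∀ i, MeasurableSpace (K i)] [∀ i, DiscreteMeasurableSpace (K i)]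
    (S₁ : Type v) [Countable S₁] [Infinite S₁] (S₂ : Type w) [Countable S₂] [Infinite S₂]
    (μ : Measure (Exch.Hypergraph K S₁)) [IsProbabilityMeasure μ] (hμ : Exch.IsExchangeable μ) :
    (∃! μ' : Measure (Exch.Hypergraph K (S₁ ⊕ S₂)), Exch.IsExchangeableExtension μ μ') ∧
    ∀ (μ' : Measure (Exch.Hypergraph K (S₁ ⊕ S₂))) [IsProbabilityMeasure μ'],
      Exch.IsExchangeableExtension μ μ' →
      ∃ (Z : Fin (k + 1) → Type (max u w)) (_ : ∀ i, MetricSpace (Z i))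
        (_ : ∀ i, CompactSpace (Z i)) (_ : ∀ i, TotallyDisconnectedSpace (Z i))
        (_ : ∀ i, MeasurableSpace (Z i)) (_ : ∀ i, BorelSpace (Z i))
        (κ : ∀ i, Z i → K i) (Λ : ∀ i, Exch.internalPalette K S₂ i → Z i),
        (∀ i, ∃ c : Z i → (ℕ → Bool), Topology.IsClosedEmbedding c) ∧
        (∀ i, Continuous (κ i)) ∧ (∀ i, Continuous (Λ i)) ∧
        (∀ i, ProbabilityTheory.iCondIndepFun (Exch.lowerRank Z S₁ i)
          (Exch.lowerRank_le Z S₁ i)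
          (fun (e : Set.powersetCard S₁ (i : ℕ)) (ω : Exch.Hypergraph Z S₁) => ω i e)
          ((μ'.map Exch.internalize).map (Exch.power Λ S₁))) ∧
        μ = ((μ'.map Exch.internalize).map (Exch.power Λ S₁)).map (Exch.power κ S₁) := by
  refine ⟨hμ.existsUnique_extension, fun μ' _ hμ' => ?_⟩
  have hΦ := Exch.measurable_internalize (K := K) (S₁ := S₁) (S₂ := S₂)
  have hid : Exch.power (fun (i : Fin (k + 1)) (z : Exch.internalPalette K S₂ i) => z) S₁ = id :=
    rfl
  have hcount : ∀ n, Countable (Set.powersetCard S₂ n) := fun n =>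
    Subtype.val_injective.countable
  -- Each internal colour space is a countable product of finite discrete spaces, hence compact,
  -- metrizable and totally disconnected; the chosen metric induces the product topology.
  refine ⟨Exch.internalPalette K S₂, fun i => TopologicalSpace.metrizableSpaceMetric _,
    fun i => inferInstance, fun i => inferInstance, fun i => inferInstance,
    fun i => inferInstance, Exch.uncolor K S₂, fun i z => z, fun i => ?_, fun i => ?_,
    fun i => continuous_id, fun i => ?_, ?_⟩
  · refine Exch.exists_isClosedEmbedding_cantor
      (ι := Σ j : {j : Fin (k + 1) // i ≤ j}, Set.powersetCard S₂ ((j.1 : ℕ) - (i : ℕ)))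
      (fun jw z => z jw.1 jw.2) (fun jw => ?_)
      fun x y h => funext fun j => funext fun w => h ⟨j, w⟩
    exact (continuous_apply jw.2).comp (continuous_apply jw.1)
  · exact (continuous_apply _).comp (continuous_apply _)
  · simp only [hid, Measure.map_id]
    exact Exch.iCondIndepFun_internalize hμ'.isExchangeable i
  · have hκ : ∀ i, Measurable (Exch.uncolor K S₂ i) := fun i =>
      (measurable_pi_apply _).comp (measurable_pi_apply _)
    rw [hid, Measure.map_id, Measure.map_map (Exch.measurable_power hκ S₁) hΦ,
      ← hμ'.map_restrict]
    congr 1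
    funext ω
    exact (Exch.power_uncolor_internalize ω).symm
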